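/- For a finite graph $F$ on $\ell$ vertices and a graph $G$ on the vertex set $\{1,\dots,n\}$, let $H_F(G)$ be the $\ell$-uniform hypergraph of all $S\subseteq V(G)$ with $G[S]\cong F$. For $\mathbf x\in\mathbb R^n$ put $P_{F,G}(\mathbf x)=\ell!\sum_{e\in H_F(G)}\prod_{i\in e}x_i$, and for real $\alpha\ge 1$ let $$\lambda_\alpha^{\mathrm{ind}}(F,G)=\max\Big\{P_{F,G}(\mathbf x):\mathbf x\in\mathbb R^n,\ \sum_{i}|x_i|^\alpha=1\Big\},\qquad \operatorname{spec}_\alpha^{\mathrm{ind}}(F,n)=\max_{v(G)=n}\lambda_\alpha^{\mathrm{ind}}(F,G).$$ Let $\operatorname{OPT}_{\alpha,F}(G)$ be the set of $\mathbf x\in\mathbb R_{\ge 0}^n$ with $\sum_i x_i^\alpha=1$ and $P_{F,G}(\mathbf x)=\lambda_\alpha^{\mathrm{ind}}(F,G)$, and let $i(F)=\lim_{n\to\infty}\max_{v(G)=n}|H_F(G)|\big/\binom n\ell$ be the inducibility of $F$. A graph is complete multipartite if non-adjacency is an equivalence relation on its vertices; its parts are the equivalence classes (a single part, i.e. an edgeless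 graph, is allowed). **Theorem.** Let $F$ be a complete multipartite graph with $\ell$ vertices. 1. For every integer $n\ge 1$ and every real $\alpha\ge 1$ there is an $n$-vertex complete multipartite graph $G$ with $\lambda_\alpha^{\mathrm{ind}}(F,G)=\operatorname{spec}_\alpha^{\mathrm{ind}}(F,n)$. 2. For every integer $n\ge 1$ and every real $\alpha\ge 1$, if an $n$-vertex complete multipartite graph $G$ satisfies $\lambda_\alpha^{\mathrm{ind}}(F,G)=\operatorname{spec}_\alpha^{\mathrm{ind}}(F,n)$, then there is $\mathbf x\in\operatorname{OPT}_{\alpha,F}(G)$ whose entries are identical on each part of $G$. 3. The limit defining $i(F)$ exists, and for every fixed real $\alpha\ge 1$, as $n\to\infty$, $\operatorname{spec}_\alpha^{\mathrm{ind}}(F,n)=(i(F)+o(1))\,n^{\ell(1-1/\alpha)}$. -/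

import Mathlib

open Filter Topology

noncomputable section

namespace SpecInd

variable {W : Type*} [Fintype W] {n : ℕ}

open Classical in
/-- The edge set of the hypergraph `H_F(G)`: all vertex sets `S` of `G` with `G[S] ≅ F`. -/
def inducedCopies (F : SimpleGraph W) (G : SimpleGraph (Fin n)) : Finset (Finset (Fin n)) :=
  Finset.univ.filter fun S => Nonempty (G.induce (S : Set (Fin n)) ≃g F)

/-- `I(F, n)`: the maximum of `|H_F(G)|` over all graphs `G` on `n` vertices. -/
def maxInducedCopies (F : SimpleGraph W) (n : ℕ) : ℕ :=
  (Finset.univ : Finset (SimpleGraph (Fin n))).sup fun G => (inducedCopies F G).card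

/-- The ratio `I(F, n) / binom(n, v(F))`. -/
def inducedDensity (F : SimpleGraph W) (n : ℕ) : ℝ :=
  (maxInducedCopies F n : ℝ) / (n.choose (Fintype.card W) : ℝ)

/-- The inducibility `i(F)`, the limit of `I(F, n) / binom(n, v(F))` as `n → ∞`. -/
def inducibility (F : SimpleGraph W) : ℝ :=
  limUnder atTop (inducedDensity F)

/-- `P_{F,G}(x) = ℓ! ∑_{e ∈ H_F(G)} ∏_{i ∈ e} x_i` with `ℓ = v(F)`. -/
def lagrangian (F : SimpleGraph W) (G : SimpleGraph (Fin n)) (x : Fin n → ℝ) : ℝ :=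
  ((Fintype.card W).factorial : ℝ) * ∑ e ∈ inducedCopies F G, ∏ i ∈ e, x i

/-- The unit sphere of the `α`-norm in `ℝ^n`. -/
def alphaSphere (α : ℝ) (n : ℕ) : Set (Fin n → ℝ) :=
  {x | ∑ i, |x i| ^ α = 1}

/-- The nonnegative part of the unit sphere of the `α`-norm. -/
def alphaSimplex (α : ℝ) (n : ℕ) : Set (Fin n → ℝ) :=
  {x | (∀ i, 0 ≤ x i) ∧ ∑ i, |x i| ^ α = 1}

/-- The `α`-spectral radius of `H_F(G)`: the maximum of `P_{F,G}` on the unit sphere of the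
`α`-norm. For `n ≥ 1`, `α ≥ 1` it is attained, see `isGreatest_specRadius`. -/
def specRadius (α : ℝ) (F : SimpleGraph W) (G : SimpleGraph (Fin n)) : ℝ :=
  sSup (lagrangian F G '' alphaSphere α n)

/-- The nonnegative optimal vectors for the `α`-spectral radius of `H_F(G)`. -/
def optVectors (α : ℝ) (F : SimpleGraph W) (G : SimpleGraph (Fin n)) : Set (Fin n → ℝ) :=
  {x | x ∈ alphaSimplex α n ∧ lagrangian F G x = specRadius α F G}

/-- The `α`-spectral inducibility number: the maximum of the `α`-spectral radius over all graphs
on `n` vertices, see `isGreatest_specInd`. -/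
def specInd (α : ℝ) (F : SimpleGraph W) (n : ℕ) : ℝ :=
  ⨆ G : SimpleGraph (Fin n), specRadius α F G

theorem isCompact_alphaSphere {α : ℝ} (hα : 1 ≤ α) (n : ℕ) : IsCompact (alphaSphere α n) := by
  have h0 : 0 < α := by linarith
  apply (isCompact_univ_pi fun _ : Fin n => isCompact_Icc (a := (-1 : ℝ)) (b := 1)).of_isClosed_subset
  · refine isClosed_eq (continuous_finsetSum _ fun i _ => ?_) continuous_const
    exact (continuous_abs.comp (continuous_apply i)).rpow_const fun _ => Or.inr h0.le
  · intro x hx i _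
    have h1 : |x i| ^ α ≤ 1 := by
      have hx' : ∑ i, |x i| ^ α = 1 := hx
      rw [← hx']
      exact Finset.single_le_sum (f := fun i => |x i| ^ α) (fun j _ => by positivity)
        (Finset.mem_univ i)
    have h2 : |x i| ≤ 1 := by
      by_contra h
      exact absurd h1 (not_le.mpr (Real.one_lt_rpow (not_le.mp h) h0))
    exact abs_le.mp h2

theorem alphaSphere_nonempty {α : ℝ} (hα : 1 ≤ α) (hn : 1 ≤ n) : (alphaSphere α n).Nonempty := by
  have h0 : α ≠ 0 := by linarith
  refine ⟨Pi.single ⟨0, hn⟩ 1, ?_⟩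
  have : ∀ i : Fin n, |(Pi.single (⟨0, hn⟩ : Fin n) (1 : ℝ) : Fin n → ℝ) i| ^ α
      = if i = ⟨0, hn⟩ then 1 else 0 := by
    intro i
    by_cases h : i = ⟨0, hn⟩ <;> simp [Pi.single_apply, h, h0]
  simp [alphaSphere, this]

theorem isGreatest_specRadius {α : ℝ} (hα : 1 ≤ α) (hn : 1 ≤ n) (F : SimpleGraph W)
    (G : SimpleGraph (Fin n)) :
    IsGreatest (lagrangian F G '' alphaSphere α n) (specRadius α F G) := by
  refine ((isCompact_alphaSphere hα n).image ?_).isGreatest_sSup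
    ((alphaSphere_nonempty hα hn).image _)
  unfold lagrangian
  fun_prop

theorem isGreatest_specInd (α : ℝ) (F : SimpleGraph W) (n : ℕ) :
    IsGreatest (Set.range fun G : SimpleGraph (Fin n) => specRadius α F G) (specInd α F n) :=
  (Set.finite_range _).isCompact.isGreatest_sSup (Set.range_nonempty _)

end SpecInd

end

/-! Part 1 is Zykov symmetrization with weights. For nonadjacent `u`, `v`, replace `v` by a clone of
`u`, or `u` by a clone of `v`. Weight the two new polynomials by `x u` and `x v` and subtract `(x u
+ x v)` times the old one: everything cancels except the contribution of copies containing both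
vertices. That contribution cannot drop, since nonadjacent vertices of a complete multipartite graph
are twins (`le_symmetrization`). So at a positive `x` both clonings preserve a maximum. Breaking
ties by the number of vertex sets that induce complete multipartite subgraphs makes nonadjacency
transitive; nonnegative `x` follow by closure.

For part 2, the polynomial sees two entries in the same part only through their sum and product.
Neither decreases when both entries are replaced by their `α`-power mean, so an optimal vector
minimizing `∑ x_i ^ (2α)` is constant on parts.

For part 3, sample `N` vertices independently from a probability vector `y` and pull `G` back:
`P_{F,G}(y)` is at most the density at every `N ≥ ℓ` (`lagrangian_le_inducedDensity`). The uniform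
vector makes this asymptotically tight, so the limit exists and bounds `P_{F,G}` on the simplex.
Homogeneity and `∑ x_i ≤ n ^ (1 - 1/α)` carry the bound to the `α`-sphere; a constant vector gives
the matching lower bound. -/

namespace SpecInd

/-! ### Weighted Zykov symmetrization -/

section TwoVertices

variable {V : Type*} [Fintype V] [DecidableEq V]

/-- The sum of `f` over all finite sets, split by the membership of two vertices `u`, `v`. -/
theorem sum_finset_eq_sum_powerset_compl_pair {u v : V} (huv : u ≠ v) (f : Finset V → ℝ) :
    ∑ S, f S = ∑ T ∈ ({u, v} : Finset V)ᶜ.powerset,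
      (f T + f (insert v T) + f (insert u T) + f (insert u (insert v T))) := by
  have h1 : (Finset.univ : Finset (Finset V))
      = (insert u (insert v ({u, v} : Finset V)ᶜ)).powerset := by
    ext S
    simp only [Finset.mem_univ, Finset.mem_powerset, true_iff]
    intro a _
    simp only [Finset.mem_insert, Finset.mem_compl, Finset.mem_singleton]
    tauto
  have hv : v ∉ ({u, v} : Finset V)ᶜ := by simp
  have hu : u ∉ insert v ({u, v} : Finset V)ᶜ := by simp [huv]
  rw [h1, Finset.sum_powerset_insert hu, Finset.sum_powerset_insert hv,
    Finset.sum_powerset_insert hv]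
  simp only [Finset.sum_add_distrib]
  ring

open Classical in
/-- The generating polynomial `∑_{S, p S} ∏_{i ∈ S} x_i` of a family of finite sets. -/
noncomputable def setPoly (p : Finset V → Prop) (x : V → ℝ) : ℝ :=
  ∑ S with p S, ∏ i ∈ S, x i

open Classical in
/-- The indicator function of a family of finite sets. -/
noncomputable def setInd (p : Finset V → Prop) (S : Finset V) : ℝ :=
  if p S then 1 else 0

omit [Fintype V] [DecidableEq V] in
theorem setInd_mono {p q : Finset V → Prop} {S T : Finset V} (h : p S → q T) :
    setInd p S ≤ setInd q T := by
  unfold setInd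
  split_ifs with h1 h2
  exacts [le_rfl, absurd (h h1) h2, zero_le_one, le_rfl]

omit [Fintype V] [DecidableEq V] in
theorem setInd_congr {p q : Finset V → Prop} {S T : Finset V} (h : p S ↔ q T) :
    setInd p S = setInd q T :=
  le_antisymm (setInd_mono h.1) (setInd_mono h.2)

/-- Multilinearity isolates the dependence on `x u` and `x v`, the only variables whose coefficients
cloning can change. -/
theorem setPoly_eq {u v : V} (huv : u ≠ v) (p : Finset V → Prop) (x : V → ℝ) :
    setPoly p x = ∑ T ∈ ({u, v} : Finset V)ᶜ.powerset, (∏ i ∈ T, x i) *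
      (setInd p T + x v * setInd p (insert v T) + x u * setInd p (insert u T)
        + x u * x v * setInd p (insert u (insert v T))) := by
  have h : setPoly p x = ∑ S, setInd p S * ∏ i ∈ S, x i := by
    unfold setPoly setInd
    rw [Finset.sum_filter]
    exact Finset.sum_congr rfl fun S _ => by split_ifs <;> simp
  rw [h, sum_finset_eq_sum_powerset_compl_pair huv]
  refine Finset.sum_congr rfl fun T hT => ?_
  have hT' := Finset.mem_powerset.1 hT
  have hu : u ∉ T := fun h => by simpa using hT' h
  have hv : v ∉ T := fun h => by simpa using hT' h
  have hu' : u ∉ insert v T := by simp [huv, hu]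
  rw [Finset.prod_insert hu, Finset.prod_insert hv, Finset.prod_insert hu', Finset.prod_insert hv]
  ring

omit [Fintype V] [DecidableEq V] in
/-- A permutation of the vertices that respects adjacency on `S` restricts to an isomorphism. -/
theorem nonempty_induce_iso_of_perm {G H : SimpleGraph V} {S T : Finset V} (e : Equiv.Perm V)
    (hS : ∀ a, a ∈ S ↔ e a ∈ T) (hadj : ∀ a ∈ S, ∀ b ∈ S, H.Adj (e a) (e b) ↔ G.Adj a b) :
    Nonempty (G.induce (S : Set V) ≃g H.induce (T : Set V)) :=
  ⟨⟨e.subtypeEquiv hS, fun {a b} => hadj a a.2 b b.2⟩⟩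

/-- A property of vertex sets of graphs that only depends on the isomorphism type of the induced
subgraph, and that forces this subgraph to be complete multipartite. -/
structure IsMultipartiteProperty (q : SimpleGraph V → Finset V → Prop) : Prop where
  of_iso : ∀ (G H : SimpleGraph V) (S T : Finset V),
    Nonempty (G.induce (S : Set V) ≃g H.induce (T : Set V)) → q G S → q H T
  isCompleteMultipartite : ∀ (G : SimpleGraph V) (S : Finset V),
    q G S → (G.induce (S : Set V)).IsCompleteMultipartite

namespace IsMultipartiteProperty

variable {q : SimpleGraph V → Finset V → Prop} {G : SimpleGraph V} {u v : V} {T : Finset V}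

omit [Fintype V] [DecidableEq V] in
theorem iff_of_perm (hq : IsMultipartiteProperty q) {H : SimpleGraph V} {S : Finset V}
    (e : Equiv.Perm V) (hS : ∀ a, a ∈ S ↔ e a ∈ T)
    (hadj : ∀ a ∈ S, ∀ b ∈ S, H.Adj (e a) (e b) ↔ G.Adj a b) : q G S ↔ q H T := by
  obtain ⟨i⟩ := nonempty_induce_iso_of_perm e hS hadj
  exact ⟨hq.of_iso _ _ _ _ ⟨i⟩, hq.of_iso _ _ _ _ ⟨i.symm⟩⟩

omit [Fintype V] in
theorem replaceVertex_iff_of_notMem (hq : IsMultipartiteProperty q) (hv : v ∉ T) :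
    q (G.replaceVertex u v) T ↔ q G T := by
  refine hq.iff_of_perm 1 (fun a => Iff.rfl) fun a ha b hb => ?_
  have hav : a ≠ v := fun h => hv (h ▸ ha)
  have hbv : b ≠ v := fun h => hv (h ▸ hb)
  exact (G.adj_replaceVertex_iff_of_ne u hav hbv).symm

omit [Fintype V] in
theorem replaceVertex_insert_iff (hq : IsMultipartiteProperty q) (huv : u ≠ v) (hu : u ∉ T)
    (hv : v ∉ T) : q (G.replaceVertex u v) (insert v T) ↔ q G (insert u T) := by
  have hs : ∀ a ∈ T, Equiv.swap u v a = a := fun a ha =>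
    Equiv.swap_apply_of_ne_of_ne (fun h => hu (h ▸ ha)) fun h => hv (h ▸ ha)
  refine hq.iff_of_perm (Equiv.swap u v) (fun a => ?_) ?_
  · by_cases hau : a = u
    · subst hau; simp [hu, hv, huv.symm, huv]
    · by_cases hav : a = v
      · subst hav; simp
      · rw [Equiv.swap_apply_of_ne_of_ne hau hav]; simp [hau, hav]
  · intro a ha b hb
    rcases Finset.mem_insert.1 ha with rfl | ha' <;> rcases Finset.mem_insert.1 hb with rfl | hb'
    · simp
    · have hbv : b ≠ a := fun h => hv (h ▸ hb')
      rw [Equiv.swap_apply_right, hs b hb', G.adj_replaceVertex_iff_of_ne_right u hbv]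
    · have hbv : a ≠ b := fun h => hv (h ▸ ha')
      rw [Equiv.swap_apply_right, hs a ha', (G.replaceVertex u b).adj_comm a b,
        G.adj_replaceVertex_iff_of_ne_right u hbv, G.adj_comm]
    · have hav : a ≠ v := fun h => hv (h ▸ ha')
      have hbv : b ≠ v := fun h => hv (h ▸ hb')
      rw [hs a ha', hs b hb', G.adj_replaceVertex_iff_of_ne u hav hbv]

omit [Fintype V] in
/-- Non-adjacent vertices of a copy are twins in it, so the copy survives cloning. -/
theorem replaceVertex_of_mem (hq : IsMultipartiteProperty q) (huv : ¬ G.Adj u v)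
    (hu : u ∈ T) (hv : v ∈ T) (h : q G T) : q (G.replaceVertex u v) T := by
  have hcm := (hq.isCompleteMultipartite G T h).trans
  have key : ∀ a ∈ T, ¬ G.Adj u a ↔ ¬ G.Adj v a := by
    intro a ha
    exact ⟨fun h => hcm ⟨v, hv⟩ ⟨u, hu⟩ ⟨a, ha⟩ (fun h' => huv h'.symm) h,
      fun h => hcm ⟨u, hu⟩ ⟨v, hv⟩ ⟨a, ha⟩ huv h⟩
  refine (hq.iff_of_perm 1 (fun a => Iff.rfl) fun a ha b hb => ?_).1 h
  change (G.replaceVertex u v).Adj a b ↔ G.Adj a b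
  by_cases hav : a = v
  · subst hav
    by_cases hba : b = a
    · subst hba; simp
    · rw [G.adj_replaceVertex_iff_of_ne_right u hba]
      exact not_iff_not.1 (key b hb)
  · by_cases hbv : b = v
    · subst hbv
      rw [SimpleGraph.adj_comm, G.adj_replaceVertex_iff_of_ne_right u hav, G.adj_comm a b]
      exact not_iff_not.1 (key a ha)
    · exact G.adj_replaceVertex_iff_of_ne u hav hbv

/-- After cloning, `v` plays the role of `u`, so the coefficient of `x v` becomes that of `x u`;
only the coefficient of `x u * x v` is not determined by this symmetry. -/
theorem setPoly_replaceVertex_right (hq : IsMultipartiteProperty q) (huv : u ≠ v) (x : V → ℝ) :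
    setPoly (q (G.replaceVertex u v)) x = ∑ T ∈ ({u, v} : Finset V)ᶜ.powerset, (∏ i ∈ T, x i) *
      (setInd (q G) T + x v * setInd (q G) (insert u T) + x u * setInd (q G) (insert u T)
        + x u * x v * setInd (q (G.replaceVertex u v)) (insert u (insert v T))) := by
  rw [setPoly_eq huv]
  refine Finset.sum_congr rfl fun T hT => ?_
  have hT' := Finset.mem_powerset.1 hT
  have hu : u ∉ T := fun h => by simpa using hT' h
  have hv : v ∉ T := fun h => by simpa using hT' h
  rw [setInd_congr (hq.replaceVertex_iff_of_notMem hv),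
    setInd_congr (hq.replaceVertex_insert_iff huv hu hv),
    setInd_congr (hq.replaceVertex_iff_of_notMem (T := insert u T) (by simp [huv.symm, hv]))]

theorem setPoly_replaceVertex_left (hq : IsMultipartiteProperty q) (huv : u ≠ v) (x : V → ℝ) :
    setPoly (q (G.replaceVertex v u)) x = ∑ T ∈ ({u, v} : Finset V)ᶜ.powerset, (∏ i ∈ T, x i) *
      (setInd (q G) T + x v * setInd (q G) (insert v T) + x u * setInd (q G) (insert v T)
        + x u * x v * setInd (q (G.replaceVertex v u)) (insert u (insert v T))) := by
  rw [hq.setPoly_replaceVertex_right huv.symm, Finset.pair_comm]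
  refine Finset.sum_congr rfl fun T _ => ?_
  rw [Finset.insert_comm]
  ring

/-- The weighted gain of the two clonings of a non-adjacent pair. -/
theorem symmetrization_gain (hq : IsMultipartiteProperty q) (huv : u ≠ v) (x : V → ℝ) :
    x u * setPoly (q (G.replaceVertex u v)) x + x v * setPoly (q (G.replaceVertex v u)) x
        - (x u + x v) * setPoly (q G) x =
      ∑ T ∈ ({u, v} : Finset V)ᶜ.powerset, (∏ i ∈ T, x i) * (x u * x v) *
        (x u * (setInd (q (G.replaceVertex u v)) (insert u (insert v T))
            - setInd (q G) (insert u (insert v T)))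
          + x v * (setInd (q (G.replaceVertex v u)) (insert u (insert v T))
            - setInd (q G) (insert u (insert v T)))) := by
  rw [hq.setPoly_replaceVertex_right huv, hq.setPoly_replaceVertex_left huv, setPoly_eq huv,
    Finset.mul_sum, Finset.mul_sum, Finset.mul_sum, ← Finset.sum_add_distrib,
    ← Finset.sum_sub_distrib]
  exact Finset.sum_congr rfl fun T _ => by ring

omit [Fintype V] in
theorem symmetrization_gain_term_nonneg (hq : IsMultipartiteProperty q) (huv : ¬ G.Adj u v)
    {x : V → ℝ} (hx : ∀ i, 0 ≤ x i) (T : Finset V) :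
    0 ≤ (∏ i ∈ T, x i) * (x u * x v) *
        (x u * (setInd (q (G.replaceVertex u v)) (insert u (insert v T))
            - setInd (q G) (insert u (insert v T)))
          + x v * (setInd (q (G.replaceVertex v u)) (insert u (insert v T))
            - setInd (q G) (insert u (insert v T)))) := by
  have hT : 0 ≤ ∏ i ∈ T, x i := Finset.prod_nonneg fun i _ => hx i
  have h1 := setInd_mono (hq.replaceVertex_of_mem (T := insert u (insert v T)) huv
    (by simp) (by simp))
  have h2 := setInd_mono (hq.replaceVertex_of_mem (T := insert u (insert v T))
    (fun h => huv h.symm) (by simp) (by simp))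
  have := hx u
  have := hx v
  exact mul_nonneg (by positivity) (add_nonneg (mul_nonneg (hx u) (sub_nonneg.2 h1))
    (mul_nonneg (hx v) (sub_nonneg.2 h2)))

theorem le_symmetrization (hq : IsMultipartiteProperty q) (hne : u ≠ v) (huv : ¬ G.Adj u v)
    {x : V → ℝ} (hx : ∀ i, 0 ≤ x i) :
    (x u + x v) * setPoly (q G) x ≤
      x u * setPoly (q (G.replaceVertex u v)) x + x v * setPoly (q (G.replaceVertex v u)) x := by
  rw [← sub_nonneg, hq.symmetrization_gain hne]
  exact Finset.sum_nonneg fun T _ => hq.symmetrization_gain_term_nonneg huv hx T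

end IsMultipartiteProperty

-- Lets the cloning inequality be applied to the tie-breaking count as well.
omit [Fintype V] [DecidableEq V] in
theorem isMultipartiteProperty_isCompleteMultipartite :
    IsMultipartiteProperty fun (G : SimpleGraph V) (S : Finset V) =>
      (G.induce (S : Set V)).IsCompleteMultipartite where
  of_iso := by
    rintro G H S T ⟨i⟩ h
    refine ⟨fun a b c hab hbc => ?_⟩
    have := h.trans (i.symm a) (i.symm b) (i.symm c)
    simp only [i.symm.map_adj_iff] at this
    exact this hab hbc
  isCompleteMultipartite := fun _ _ h => h

/-- For three vertices spanning only the edge `u w`, the two clonings of the pair `u`, `v`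
strictly increase the number of complete multipartite induced subgraphs in total. -/
theorem card_symmetrization_lt {G : SimpleGraph V} {u v w : V} (huv : ¬ G.Adj u v)
    (hvw : ¬ G.Adj v w) (huw : G.Adj u w) :
    2 * setPoly (fun S : Finset V => (G.induce (S : Set V)).IsCompleteMultipartite) 1 <
      setPoly (fun S : Finset V =>
        ((G.replaceVertex u v).induce (S : Set V)).IsCompleteMultipartite) 1 +
      setPoly (fun S : Finset V =>
        ((G.replaceVertex v u).induce (S : Set V)).IsCompleteMultipartite) 1 := by
  have hq := isMultipartiteProperty_isCompleteMultipartite (V := V)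
  have hne : u ≠ v := fun h => hvw (h ▸ huw)
  have hwv : w ≠ v := fun h => huv (h ▸ huw)
  have hwu : w ≠ u := huw.ne'
  have hgain := hq.symmetrization_gain (G := G) hne 1
  have hnn := hq.symmetrization_gain_term_nonneg (x := 1) huv (by simp)
  -- One term suffices for strictness: `T = {w}`, that is, the triple `u`, `v`, `w`. It is not
  -- complete multipartite in `G`, but becomes edgeless when `u` is made a clone of `v`.
  have hle := Finset.single_le_sum (fun T _ => hnn T)
    (show {w} ∈ ({u, v} : Finset V)ᶜ.powerset by simp [hwu, hwv])
  rw [← hgain] at hle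
  have h1 := setInd_mono
    (p := fun S : Finset V => (G.induce (S : Set V)).IsCompleteMultipartite)
    (q := fun S : Finset V =>
      ((G.replaceVertex u v).induce (S : Set V)).IsCompleteMultipartite)
    (hq.replaceVertex_of_mem (T := insert u (insert v {w})) huv
    (by simp) (by simp))
  have h2 : setInd (fun S : Finset V => (G.induce (S : Set V)).IsCompleteMultipartite)
      (insert u (insert v {w})) = 0 := by
    unfold setInd
    rw [if_neg]
    intro h
    exact h.trans ⟨u, by simp⟩ ⟨v, by simp⟩ ⟨w, by simp⟩ huv hvw huw
  have h3 : setInd (fun S : Finset V =>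
      ((G.replaceVertex v u).induce (S : Set V)).IsCompleteMultipartite)
      (insert u (insert v {w})) = 1 := by
    unfold setInd
    rw [if_pos]
    have hno : ∀ a ∈ insert u (insert v ({w} : Finset V)), ∀ b ∈ insert u (insert v ({w} : Finset V)),
        ¬ (G.replaceVertex v u).Adj a b := by
      have hwv' : ¬ G.Adj w v := fun h => hvw h.symm
      intro a ha b hb
      simp only [Finset.mem_insert, Finset.mem_singleton] at ha hb
      rcases ha with rfl | rfl | rfl <;> rcases hb with rfl | rfl | rfl <;>
        simp [SimpleGraph.replaceVertex, *]
    exact ⟨fun a b c _ _ => hno a a.2 c c.2⟩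
  simp only [Pi.one_apply, one_mul, Finset.prod_const_one] at hle
  linarith

/-- At a positive vector, the generating polynomial of `q` is maximized by a complete multipartite
graph. -/
theorem IsMultipartiteProperty.exists_isCompleteMultipartite_of_pos
    {q : SimpleGraph V → Finset V → Prop} (hq : IsMultipartiteProperty q) {x : V → ℝ}
    (hx : ∀ i, 0 < x i) :
    ∃ G : SimpleGraph V, G.IsCompleteMultipartite ∧
      ∀ H : SimpleGraph V, setPoly (q H) x ≤ setPoly (q G) x := by
  classical
  -- Lexicographic order: the second coordinate only chooses among maximizers of the polynomial.
  let f : SimpleGraph V → ℝ ×ₗ ℝ := fun G => toLex (setPoly (q G) x,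
    setPoly (fun S : Finset V => (G.induce (S : Set V)).IsCompleteMultipartite) 1)
  obtain ⟨G, hG⟩ := Finite.exists_max f
  have hmax : ∀ H, setPoly (q H) x ≤ setPoly (q G) x := fun H => by
    rcases Prod.Lex.toLex_le_toLex.1 (hG H) with h | h
    exacts [h.le, h.1.le]
  refine ⟨G, ⟨fun u v w huv hvw huw => ?_⟩, hmax⟩
  have hne : u ≠ v := fun h => hvw (h ▸ huw)
  have h1 := hq.le_symmetrization hne huv fun i => (hx i).le
  have hu := hx u
  have hv := hx v
  -- If one clone fell below the maximum, its positive weight would force the other clone above it.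
  have e1 : setPoly (q (G.replaceVertex u v)) x = setPoly (q G) x := by
    refine (hmax _).antisymm (not_lt.1 fun h => ?_)
    nlinarith [hmax (G.replaceVertex v u)]
  have e2 : setPoly (q (G.replaceVertex v u)) x = setPoly (q G) x := by
    refine (hmax _).antisymm (not_lt.1 fun h => ?_)
    nlinarith [hmax (G.replaceVertex u v)]
  have hQ : ∀ H, setPoly (q H) x = setPoly (q G) x →
      setPoly (fun S : Finset V => (H.induce (S : Set V)).IsCompleteMultipartite) 1 ≤
      setPoly (fun S : Finset V => (G.induce (S : Set V)).IsCompleteMultipartite) 1 := by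
    intro H hH
    rcases Prod.Lex.toLex_le_toLex.1 (hG H) with h | h
    exacts [absurd hH h.ne, h.2]
  linarith [hQ _ e1, hQ _ e2, card_symmetrization_lt huv hvw huw]

omit [DecidableEq V] in
theorem continuous_setPoly (p : Finset V → Prop) : Continuous (setPoly p) := by
  unfold setPoly
  fun_prop

/-- At a nonnegative vector, the generating polynomial of `q` does not decrease for a suitable
complete multipartite graph. -/
theorem IsMultipartiteProperty.exists_isCompleteMultipartite
    {q : SimpleGraph V → Finset V → Prop} (hq : IsMultipartiteProperty q) (H : SimpleGraph V)
    {x : V → ℝ} (hx : ∀ i, 0 ≤ x i) :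
    ∃ G : SimpleGraph V, G.IsCompleteMultipartite ∧ setPoly (q H) x ≤ setPoly (q G) x := by
  -- There are finitely many candidates `G`, so the set of good vectors is closed; it contains the
  -- positive orthant, whose closure contains `x`.
  have hclosed : IsClosed (⋃ G ∈ {G : SimpleGraph V | G.IsCompleteMultipartite},
      {x : V → ℝ | setPoly (q H) x ≤ setPoly (q G) x}) :=
    (Set.toFinite _).isClosed_biUnion fun G _ =>
      isClosed_le (continuous_setPoly _) (continuous_setPoly _)
  have hsub : Set.univ.pi (fun _ : V => Set.Ioi (0 : ℝ)) ⊆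
      ⋃ G ∈ {G : SimpleGraph V | G.IsCompleteMultipartite},
      {x : V → ℝ | setPoly (q H) x ≤ setPoly (q G) x} := by
    intro y hy
    obtain ⟨G, hG, hmax⟩ := hq.exists_isCompleteMultipartite_of_pos fun i => hy i trivial
    exact Set.mem_biUnion hG (hmax H)
  have hmem : x ∈ closure (Set.univ.pi (fun _ : V => Set.Ioi (0 : ℝ))) := by
    rw [closure_pi_set]
    intro i _
    rw [closure_Ioi]
    exact hx i
  simpa using hclosed.closure_subset_iff.2 hsub hmem

end TwoVertices

/-! ### Extremal graphs can be taken complete multipartite -/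

section Copies

variable {W : Type*} [Fintype W] {n : ℕ}

omit [Fintype W] in
theorem isMultipartiteProperty_copy {F : SimpleGraph W} (hF : F.IsCompleteMultipartite) :
    IsMultipartiteProperty fun (G : SimpleGraph (Fin n)) (S : Finset (Fin n)) =>
      Nonempty (G.induce (S : Set (Fin n)) ≃g F) where
  of_iso := by
    rintro G H S T ⟨i⟩ ⟨j⟩
    exact ⟨i.symm.trans j⟩
  isCompleteMultipartite := by
    rintro G S ⟨i⟩
    refine ⟨fun a b c hab hbc => ?_⟩
    have := hF.trans (i a) (i b) (i c)
    simp only [i.map_adj_iff] at this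
    exact this hab hbc

theorem lagrangian_le_lagrangian_abs (F : SimpleGraph W) (G : SimpleGraph (Fin n))
    (x : Fin n → ℝ) : lagrangian F G x ≤ lagrangian F G fun i => |x i| := by
  unfold lagrangian
  refine mul_le_mul_of_nonneg_left (Finset.sum_le_sum fun e _ => ?_) (by positivity)
  rw [← Finset.abs_prod]
  exact le_abs_self _

theorem abs_mem_alphaSimplex {α : ℝ} {x : Fin n → ℝ} (hx : x ∈ alphaSphere α n) :
    (fun i => |x i|) ∈ alphaSimplex α n :=
  ⟨fun i => abs_nonneg _, by simpa [alphaSphere] using hx⟩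

theorem lagrangian_le_specRadius {α : ℝ} (hα : 1 ≤ α) (hn : 1 ≤ n) (F : SimpleGraph W)
    (G : SimpleGraph (Fin n)) {x : Fin n → ℝ} (hx : x ∈ alphaSphere α n) :
    lagrangian F G x ≤ specRadius α F G :=
  (isGreatest_specRadius hα hn F G).2 ⟨x, hx, rfl⟩

theorem optVectors_nonempty {α : ℝ} (hα : 1 ≤ α) (hn : 1 ≤ n) (F : SimpleGraph W)
    (G : SimpleGraph (Fin n)) : (optVectors α F G).Nonempty := by
  obtain ⟨x, hx, hxG⟩ := (isGreatest_specRadius hα hn F G).1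
  have hs := abs_mem_alphaSimplex hx
  exact ⟨_, hs, (lagrangian_le_specRadius hα hn F G hs.2).antisymm
    (hxG ▸ lagrangian_le_lagrangian_abs F G x)⟩

theorem specRadius_le_specInd (α : ℝ) (F : SimpleGraph W) (G : SimpleGraph (Fin n)) :
    specRadius α F G ≤ specInd α F n :=
  (isGreatest_specInd α F n).2 ⟨G, rfl⟩

theorem exists_isCompleteMultipartite_specRadius_eq {F : SimpleGraph W}
    (hF : F.IsCompleteMultipartite) (hn : 1 ≤ n) {α : ℝ} (hα : 1 ≤ α) :
    ∃ G : SimpleGraph (Fin n), G.IsCompleteMultipartite ∧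
      specRadius α F G = specInd α F n := by
  obtain ⟨H, hH⟩ := (isGreatest_specInd α F n).1
  obtain ⟨x, hx, hxH⟩ := optVectors_nonempty hα hn F H
  obtain ⟨G, hG, hle⟩ :=
    (isMultipartiteProperty_copy (n := n) hF).exists_isCompleteMultipartite H hx.1
  refine ⟨G, hG, (specRadius_le_specInd α F G).antisymm ?_⟩
  calc specInd α F n = lagrangian F H x := by rw [hxH, ← hH]
    _ ≤ lagrangian F G x := mul_le_mul_of_nonneg_left hle (by positivity)
    _ ≤ specRadius α F G := lagrangian_le_specRadius hα hn F G hx.2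

end Copies

/-! ### Twins in complete multipartite graphs -/

section Twins

theorem replaceVertex_eq_self_of_not_adj {V : Type*} [DecidableEq V] {G : SimpleGraph V}
    (hG : G.IsCompleteMultipartite) {u v : V} (huv : ¬ G.Adj u v) : G.replaceVertex u v = G := by
  have key : ∀ a, G.Adj u a ↔ G.Adj v a := fun a => not_iff_not.1
    ⟨fun h => hG.trans v u a (fun h' => huv h'.symm) h, fun h => hG.trans u v a huv h⟩
  ext a b
  by_cases hav : a = v
  · subst hav
    by_cases hba : b = a
    · subst hba; simp
    · rw [G.adj_replaceVertex_iff_of_ne_right u hba, key]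
  · by_cases hbv : b = v
    · subst hbv
      rw [SimpleGraph.adj_comm, G.adj_replaceVertex_iff_of_ne_right u hav, key, G.adj_comm]
    · rw [G.adj_replaceVertex_iff_of_ne u hav hbv]

/-- The generating polynomial of a graph with twins `u`, `v` is symmetric in `x_u`, `x_v`, hence
monotone in `x_u + x_v` and `x_u x_v`. -/
theorem IsMultipartiteProperty.setPoly_le_of_twins {V : Type*} [Fintype V] [DecidableEq V]
    {q : SimpleGraph V → Finset V → Prop} (hq : IsMultipartiteProperty q) {G : SimpleGraph V}
    {u v : V} (hne : u ≠ v) (htwin : G.replaceVertex u v = G) {x y : V → ℝ}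
    (hx : ∀ i, 0 ≤ x i) (hy : ∀ i ∉ ({u, v} : Finset V), y i = x i)
    (hadd : x u + x v ≤ y u + y v) (hmul : x u * x v ≤ y u * y v) :
    setPoly (q G) x ≤ setPoly (q G) y := by
  -- Cloning does not change `G`, so the expansion of the clone is one of `G` itself, with equal
  -- coefficients for `x u` and `x v`.
  have h := fun z => hq.setPoly_replaceVertex_right (G := G) hne z
  simp only [htwin] at h
  rw [h, h]
  refine Finset.sum_le_sum fun T hT => ?_
  have hT' := Finset.mem_powerset.1 hT
  rw [Finset.prod_congr rfl fun i hi => hy i (Finset.mem_compl.1 (hT' hi))]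
  have h0 : ∀ S, 0 ≤ setInd (q G) S := fun S => by unfold setInd; split_ifs <;> norm_num
  refine mul_le_mul_of_nonneg_left ?_ (Finset.prod_nonneg fun i _ => hx i)
  have h1 := mul_le_mul_of_nonneg_right hadd (h0 (insert u T))
  have h2 := mul_le_mul_of_nonneg_right hmul (h0 (insert u (insert v T)))
  linarith

end Twins

/-! ### Optimal vectors constant on parts -/

section Optimal

variable {W : Type*} [Fintype W] {n : ℕ}

theorem continuous_lagrangian (F : SimpleGraph W) (G : SimpleGraph (Fin n)) :
    Continuous (lagrangian F G) := by
  unfold lagrangian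
  fun_prop

theorem isCompact_optVectors {α : ℝ} (hα : 1 ≤ α) (F : SimpleGraph W)
    (G : SimpleGraph (Fin n)) : IsCompact (optVectors α F G) := by
  have h : optVectors α F G = alphaSphere α n ∩
      ((⋂ i, {x | 0 ≤ x i}) ∩ {x | lagrangian F G x = specRadius α F G}) := by
    ext x
    simp only [optVectors, alphaSimplex, alphaSphere, Set.mem_ofPred_eq, Set.mem_inter_iff,
      Set.mem_iInter]
    tauto
  rw [h]
  exact (isCompact_alphaSphere hα n).inter_right
    ((isClosed_iInter fun i => isClosed_le continuous_const (continuous_apply i)).inter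
      (isClosed_eq (continuous_lagrangian F G) continuous_const))

/-- The power mean of two nonnegative numbers. -/
theorem exists_power_mean {α : ℝ} (hα : 1 ≤ α) {a b : ℝ} (ha : 0 ≤ a) (hb : 0 ≤ b) :
    ∃ m, 0 ≤ m ∧ m ^ α = (a ^ α + b ^ α) / 2 ∧ a + b ≤ m + m ∧ a * b ≤ m * m := by
  have h0 : α ≠ 0 := by linarith
  have hs : 0 ≤ (a ^ α + b ^ α) / 2 := by positivity
  have hm : 0 ≤ ((a ^ α + b ^ α) / 2) ^ α⁻¹ := by positivity
  have hpow : (((a ^ α + b ^ α) / 2) ^ α⁻¹) ^ α = (a ^ α + b ^ α) / 2 :=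
    Real.rpow_inv_rpow hs h0
  have hle : (a + b) / 2 ≤ ((a ^ α + b ^ α) / 2) ^ α⁻¹ := by
    rw [← Real.rpow_le_rpow_iff (by positivity) hm (by linarith : 0 < α), hpow]
    have h := (convexOn_rpow hα).2 (Set.mem_Ici.2 ha) (Set.mem_Ici.2 hb)
      (by norm_num : (0 : ℝ) ≤ 1 / 2) (by norm_num : (0 : ℝ) ≤ 1 / 2) (by norm_num)
    simp only [smul_eq_mul] at h
    calc ((a + b) / 2) ^ α = (1 / 2 * a + 1 / 2 * b) ^ α := by congr 1; ring
      _ ≤ _ := h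
      _ = _ := by ring
  exact ⟨_, hm, hpow, by linarith, by nlinarith [sq_nonneg (a - b)]⟩

theorem exists_optVectors_eq_of_not_adj {F : SimpleGraph W} (hF : F.IsCompleteMultipartite)
    (hn : 1 ≤ n) {α : ℝ} (hα : 1 ≤ α) {G : SimpleGraph (Fin n)} (hG : G.IsCompleteMultipartite) :
    ∃ x ∈ optVectors α F G, ∀ u v, ¬ G.Adj u v → x u = x v := by
  have h0 : 0 < α := by linarith
  -- On the sphere `∑ |x i| ^ α` is fixed, so this sum of squares measures how unequal the entries
  -- are; averaging two distinct `α`-powers strictly lowers it.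
  have hcont : Continuous fun x : Fin n → ℝ => ∑ i, (|x i| ^ α) ^ 2 := by
    refine continuous_finsetSum _ fun i _ => Continuous.pow ?_ 2
    exact (continuous_abs.comp (continuous_apply i)).rpow_const fun _ => Or.inr h0.le
  obtain ⟨x, hx, hmin⟩ := (isCompact_optVectors hα F G).exists_isMinOn
    (optVectors_nonempty hα hn F G) hcont.continuousOn
  refine ⟨x, hx, fun u v huv => ?_⟩
  by_contra hxuv
  have hne : u ≠ v := fun h => hxuv (h ▸ rfl)
  have hx0 := hx.1.1
  obtain ⟨m, hm, hpow, hadd, hmul⟩ := exists_power_mean hα (hx0 u) (hx0 v)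
  set y : Fin n → ℝ := fun i => if i ∈ ({u, v} : Finset (Fin n)) then m else x i with hy
  have hyu : y u = m := by simp [hy]
  have hyv : y v = m := by simp [hy]
  have hyo : ∀ i ∉ ({u, v} : Finset (Fin n)), y i = x i := fun i hi => if_neg hi
  have hy0 : ∀ i, 0 ≤ y i := fun i => by
    simp only [hy]
    split_ifs
    exacts [hm, hx0 i]
  have hsplit : ∀ f : Fin n → ℝ,
      ∑ i, f i = f u + f v + ∑ i ∈ ({u, v} : Finset (Fin n))ᶜ, f i := fun f => by
    rw [← Finset.sum_add_sum_compl {u, v}, Finset.sum_pair hne]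
  have hrest : ∀ g : ℝ → ℝ, ∑ i ∈ ({u, v} : Finset (Fin n))ᶜ, g (y i)
      = ∑ i ∈ ({u, v} : Finset (Fin n))ᶜ, g (x i) := fun g =>
    Finset.sum_congr rfl fun i hi => by rw [hyo i (Finset.mem_compl.1 hi)]
  have hysphere : y ∈ alphaSphere α n := by
    have h1 := hx.1.2
    rw [hsplit] at h1
    change ∑ i, |y i| ^ α = 1
    rw [hsplit, hrest fun t => |t| ^ α, hyu, hyv, abs_of_nonneg hm, hpow, ← h1,
      abs_of_nonneg (hx0 u), abs_of_nonneg (hx0 v)]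
    ring
  have hle : lagrangian F G x ≤ lagrangian F G y :=
    mul_le_mul_of_nonneg_left ((isMultipartiteProperty_copy hF).setPoly_le_of_twins hne
      (replaceVertex_eq_self_of_not_adj hG huv) hx0 hyo (by rwa [hyu, hyv]) (by rwa [hyu, hyv]))
      (by positivity)
  have hyopt : y ∈ optVectors α F G := ⟨⟨hy0, hysphere⟩,
    (lagrangian_le_specRadius hα hn F G hysphere).antisymm (hx.2 ▸ hle)⟩
  have hlt := hmin hyopt
  simp only [Set.mem_ofPred_eq] at hlt
  rw [hsplit, hsplit fun i => (|y i| ^ α) ^ 2, hrest fun t => (|t| ^ α) ^ 2, hyu, hyv,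
    abs_of_nonneg hm, hpow, abs_of_nonneg (hx0 u), abs_of_nonneg (hx0 v)] at hlt
  have hab : x u ^ α - x v ^ α = 0 := by
    rw [← sq_eq_zero_iff]
    nlinarith [sq_nonneg (x u ^ α - x v ^ α)]
  exact hxuv ((Real.rpow_left_inj (hx0 u) (hx0 v) h0.ne').1 (sub_eq_zero.1 hab))

end Optimal

/-! ### Random sampling bounds the Lagrangian by the density -/

section Sampling

variable {W : Type*} [Fintype W] {n : ℕ}

omit [Fintype W] in
theorem mem_inducedCopies {F : SimpleGraph W} {G : SimpleGraph (Fin n)} {S : Finset (Fin n)} :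
    S ∈ inducedCopies F G ↔ Nonempty (G.induce (S : Set (Fin n)) ≃g F) := by
  simp [inducedCopies]

theorem card_of_mem_inducedCopies {F : SimpleGraph W} {G : SimpleGraph (Fin n)}
    {S : Finset (Fin n)} (h : S ∈ inducedCopies F G) : S.card = Fintype.card W := by
  obtain ⟨i⟩ := mem_inducedCopies.1 h
  rw [← Fintype.card_coe]
  exact Fintype.card_congr i.toEquiv

omit [Fintype W] in
theorem card_inducedCopies_le (F : SimpleGraph W) (G : SimpleGraph (Fin n)) :
    (inducedCopies F G).card ≤ maxInducedCopies F n :=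
  Finset.le_sup (f := fun G => (inducedCopies F G).card) (Finset.mem_univ G)

omit [Fintype W] in
theorem exists_card_inducedCopies_eq (F : SimpleGraph W) (n : ℕ) :
    ∃ G : SimpleGraph (Fin n), (inducedCopies F G).card = maxInducedCopies F n := by
  obtain ⟨G, _, hG⟩ := Finset.exists_mem_eq_sup (Finset.univ : Finset (SimpleGraph (Fin n)))
    Finset.univ_nonempty fun G => (inducedCopies F G).card
  exact ⟨G, hG.symm⟩

theorem inducedDensity_nonneg (F : SimpleGraph W) (n : ℕ) : 0 ≤ inducedDensity F n := by
  unfold inducedDensity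
  positivity

/-- The probability that a random function with independent values extends a given bijection. -/
theorem sum_prod_extending {N : ℕ} {y : Fin n → ℝ} (hy : ∑ i, y i = 1) {T : Finset (Fin N)}
    {e : Finset (Fin n)} (σ : T ≃ e) :
    ∑ f : Fin N → Fin n, (if ∀ j : T, f j = σ j then ∏ j, y (f j) else 0) = ∏ i ∈ e, y i := by
  classical
  have h1 : ∀ f : Fin N → Fin n, (if ∀ j : T, f j = σ j then ∏ j, y (f j) else 0)
      = ∏ j, if ∀ h : j ∈ T, f j = σ ⟨j, h⟩ then y (f j) else 0 := fun f => by
    rw [Fintype.prod_ite_zero]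
    simp
  have h2 : ∀ j : Fin N, (∑ i : Fin n, if ∀ h : j ∈ T, i = σ ⟨j, h⟩ then y i else 0)
      = if h : j ∈ T then y (σ ⟨j, h⟩) else 1 := fun j => by
    by_cases h : j ∈ T <;> simp [h, hy]
  calc _ = ∑ f : Fin N → Fin n, ∏ j, if ∀ h : j ∈ T, f j = σ ⟨j, h⟩ then y (f j) else 0 :=
        Finset.sum_congr rfl fun f _ => by rw [← h1]
    _ = ∏ j : Fin N, ∑ i : Fin n, if ∀ h : j ∈ T, i = σ ⟨j, h⟩ then y i else 0 := by
        rw [Finset.prod_univ_sum, Fintype.piFinset_univ]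
    _ = ∏ j : Fin N, if h : j ∈ T then y (σ ⟨j, h⟩) else 1 :=
        Finset.prod_congr rfl fun j _ => h2 j
    _ = ∏ j ∈ T, if h : j ∈ T then y (σ ⟨j, h⟩) else 1 :=
        (Finset.prod_subset (Finset.subset_univ T) fun j _ hj => dif_neg hj).symm
    _ = ∏ j : T, y (σ j) := by
        rw [← Finset.prod_coe_sort]
        exact Finset.prod_congr rfl fun j _ => dif_pos j.2
    _ = ∏ i : e, y i := Equiv.prod_comp σ fun i : e => y i
    _ = ∏ i ∈ e, y i := Finset.prod_coe_sort e y

omit [Fintype W] in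
/-- If `f` maps `T` bijectively onto a copy of `F` in `G`, then `T` spans a copy of `F` in the
pullback of `G`. -/
theorem mem_inducedCopies_comap {N : ℕ} {F : SimpleGraph W} {G : SimpleGraph (Fin n)}
    {T : Finset (Fin N)} {e : Finset (Fin n)} (he : e ∈ inducedCopies F G) (σ : T ≃ e)
    {f : Fin N → Fin n} (hf : ∀ j : T, f j = σ j) : T ∈ inducedCopies F (G.comap f) := by
  obtain ⟨i⟩ := mem_inducedCopies.1 he
  refine mem_inducedCopies.2 ⟨RelIso.trans ⟨σ, fun {a b} => ?_⟩ i⟩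
  change G.Adj (σ a) (σ b) ↔ G.Adj (f a) (f b)
  rw [hf a, hf b]

-- The right side is the probability that `T` spans a copy of `F` in the pullback along a random
-- `f`. The left side counts only those `f` that map `T` bijectively onto a copy in `G`; the factor
-- `ℓ!` is the number of bijections from `T` to a given copy.
open Classical in
theorem lagrangian_le_sum_comap {N : ℕ} (F : SimpleGraph W) (G : SimpleGraph (Fin n))
    {y : Fin n → ℝ} (hy0 : ∀ i, 0 ≤ y i) (hy : ∑ i, y i = 1) {T : Finset (Fin N)}
    (hT : T.card = Fintype.card W) :
    lagrangian F G y ≤ ∑ f : Fin N → Fin n,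
      (if T ∈ inducedCopies F (G.comap f) then ∏ j, y (f j) else 0) := by
  have h1 : ∀ e ∈ inducedCopies F G, ((Fintype.card W).factorial : ℝ) * ∏ i ∈ e, y i
      = ∑ σ : T ≃ e, ∑ f : Fin N → Fin n, if ∀ j : T, f j = σ j then ∏ j, y (f j) else 0 := by
    intro e he
    have hcard : T.card = e.card := hT.trans (card_of_mem_inducedCopies he).symm
    rw [Finset.sum_congr rfl fun σ _ => sum_prod_extending hy σ, Finset.sum_const,
      Finset.card_univ, Fintype.card_equiv (Finset.equivOfCardEq hcard), Fintype.card_coe, hT,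
      nsmul_eq_mul]
  unfold lagrangian
  rw [Finset.mul_sum, Finset.sum_congr rfl h1, Finset.sum_sigma', Finset.sum_comm]
  refine Finset.sum_le_sum fun f _ => ?_
  have hw : 0 ≤ ∏ j, y (f j) := Finset.prod_nonneg fun j _ => hy0 _
  rw [← Finset.sum_filter, Finset.sum_const, nsmul_eq_mul]
  split_ifs with hmem
  · refine mul_le_of_le_one_left hw ?_
    -- These events are disjoint: `f` determines `e = f(T)` and `σ = f|_T`.
    rw [← Nat.cast_one, Nat.cast_le, Finset.card_le_one]
    rintro ⟨e, σ⟩ h ⟨e', σ'⟩ h'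
    have hσ := (Finset.mem_filter.1 h).2
    have hσ' := (Finset.mem_filter.1 h').2
    have himage : ∀ (s : Finset (Fin n)) (τ : T ≃ s), (∀ j : T, f j = τ j) →
        s = T.image f := by
      intro s τ hτ
      ext a
      refine ⟨fun ha => ?_, fun ha => ?_⟩
      · refine Finset.mem_image.2 ⟨τ.symm ⟨a, ha⟩, (τ.symm ⟨a, ha⟩).2, ?_⟩
        rw [hτ, Equiv.apply_symm_apply]
      · obtain ⟨j, hj, rfl⟩ := Finset.mem_image.1 ha
        rw [hτ ⟨j, hj⟩]
        exact (τ ⟨j, hj⟩).2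
    obtain rfl : e = e' := (himage e σ hσ).trans (himage e' σ' hσ').symm
    obtain rfl : σ = σ' := Equiv.ext fun j => Subtype.ext ((hσ j).symm.trans (hσ' j))
    rfl
  · rw [Finset.filter_eq_empty_iff.2]
    · simp
    · rintro ⟨e, σ⟩ he hσ
      exact hmem (mem_inducedCopies_comap (Finset.mem_sigma.1 he).1 σ hσ)

/-- Sampling `N` vertices independently from a probability vector `y`. -/
theorem lagrangian_le_inducedDensity (F : SimpleGraph W) (G : SimpleGraph (Fin n))
    {y : Fin n → ℝ} (hy0 : ∀ i, 0 ≤ y i) (hy : ∑ i, y i = 1) {N : ℕ}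
    (hN : Fintype.card W ≤ N) : lagrangian F G y ≤ inducedDensity F N := by
  classical
  have hpos : (0 : ℝ) < N.choose (Fintype.card W) := by exact_mod_cast Nat.choose_pos hN
  have hw : ∀ f : Fin N → Fin n, 0 ≤ ∏ j, y (f j) := fun f => Finset.prod_nonneg fun j _ => hy0 _
  have htotal : ∑ f : Fin N → Fin n, ∏ j, y (f j) = 1 := by
    have := Finset.prod_univ_sum (fun _ : Fin N => (Finset.univ : Finset (Fin n)))
      fun _ i => y i
    rw [Fintype.piFinset_univ] at this
    rw [← this]
    simp [hy]
  unfold inducedDensity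
  rw [le_div_iff₀ hpos]
  calc lagrangian F G y * N.choose (Fintype.card W)
      = ∑ T ∈ Finset.powersetCard (Fintype.card W) (Finset.univ : Finset (Fin N)),
          lagrangian F G y := by
        rw [Finset.sum_const, Finset.card_powersetCard, Finset.card_univ, Fintype.card_fin,
          nsmul_eq_mul, mul_comm]
    _ ≤ ∑ T ∈ Finset.powersetCard (Fintype.card W) (Finset.univ : Finset (Fin N)),
          ∑ f : Fin N → Fin n,
            (if T ∈ inducedCopies F (G.comap f) then ∏ j, y (f j) else 0) :=
        Finset.sum_le_sum fun T hT =>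
          lagrangian_le_sum_comap F G hy0 hy (Finset.mem_powersetCard.1 hT).2
    _ = ∑ f : Fin N → Fin n,
          ∑ T ∈ Finset.powersetCard (Fintype.card W) (Finset.univ : Finset (Fin N)),
            (if T ∈ inducedCopies F (G.comap f) then ∏ j, y (f j) else 0) := Finset.sum_comm
    _ ≤ ∑ f : Fin N → Fin n, (maxInducedCopies F N : ℝ) * ∏ j, y (f j) := by
        refine Finset.sum_le_sum fun f _ => ?_
        rw [← Finset.sum_filter, Finset.sum_const, nsmul_eq_mul]
        refine mul_le_mul_of_nonneg_right ?_ (hw f)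
        rw [Nat.cast_le]
        refine (Finset.card_le_card fun T hT => ?_).trans (card_inducedCopies_le F (G.comap f))
        exact (Finset.mem_filter.1 hT).2
    _ = maxInducedCopies F N := by rw [← Finset.mul_sum, htotal, mul_one]

end Sampling

/-! ### Inducibility and the asymptotics of the spectral number -/

section Asymptotics

variable {W : Type*} [Fintype W] {n : ℕ}

theorem lagrangian_smul (F : SimpleGraph W) (G : SimpleGraph (Fin n)) (s : ℝ) (x : Fin n → ℝ) :
    lagrangian F G (s • x) = s ^ Fintype.card W * lagrangian F G x := by
  unfold lagrangian
  rw [mul_left_comm]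
  congr 1
  rw [Finset.mul_sum]
  refine Finset.sum_congr rfl fun e he => ?_
  simp only [Pi.smul_apply, smul_eq_mul]
  rw [Finset.prod_mul_distrib, Finset.prod_const, card_of_mem_inducedCopies he]

theorem lagrangian_const (F : SimpleGraph W) (G : SimpleGraph (Fin n)) (t : ℝ) :
    lagrangian F G (fun _ => t) =
      (Fintype.card W).factorial * ((inducedCopies F G).card * t ^ Fintype.card W) := by
  unfold lagrangian
  congr 1
  have h : ∀ e ∈ inducedCopies F G, ∏ _i ∈ e, t = t ^ Fintype.card W := fun e he => by
    rw [Finset.prod_const, card_of_mem_inducedCopies he]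
  rw [Finset.sum_congr rfl h, Finset.sum_const, nsmul_eq_mul]

theorem exists_lagrangian_const_eq (F : SimpleGraph W) (hn : Fintype.card W ≤ n) (t : ℝ) :
    ∃ G : SimpleGraph (Fin n), lagrangian F G (fun _ => t) =
      n.descFactorial (Fintype.card W) * inducedDensity F n * t ^ Fintype.card W := by
  obtain ⟨G, hG⟩ := exists_card_inducedCopies_eq F n
  refine ⟨G, ?_⟩
  have hpos : (n.choose (Fintype.card W) : ℝ) ≠ 0 := by
    exact_mod_cast (Nat.choose_pos hn).ne'
  rw [lagrangian_const, hG, inducedDensity, Nat.descFactorial_eq_factorial_mul_choose]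
  push_cast
  field_simp

theorem tendsto_descFactorial_div_pow (k : ℕ) :
    Tendsto (fun n : ℕ => (n.descFactorial k : ℝ) / (n : ℝ) ^ k) atTop (𝓝 1) := by
  refine (Asymptotics.isEquivalent_iff_tendsto_one ?_).1 (isEquivalent_descFactorial k)
  filter_upwards [eventually_gt_atTop 0] with n hn
  positivity

/-- The inducibility bounds all Lagrangians, and is the limit of the densities. -/
theorem exists_inducedDensity_limit (F : SimpleGraph W) :
    ∃ L : ℝ, Tendsto (inducedDensity F) atTop (𝓝 L) ∧
      ∀ (n : ℕ) (G : SimpleGraph (Fin n)) (y : Fin n → ℝ), (∀ i, 0 ≤ y i) → ∑ i, y i = 1 →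
        lagrangian F G y ≤ L := by
  -- The shift by `ℓ` skips `n < ℓ`, where the binomial vanishes and the density takes the default
  -- value `0`, which would spoil the infimum.
  have hbdd : BddBelow (Set.range fun k => inducedDensity F (k + Fintype.card W)) :=
    ⟨0, by rintro _ ⟨k, rfl⟩; exact inducedDensity_nonneg F _⟩
  have hlag : ∀ (n : ℕ) (G : SimpleGraph (Fin n)) (y : Fin n → ℝ), (∀ i, 0 ≤ y i) →
      ∑ i, y i = 1 → lagrangian F G y ≤ ⨅ k, inducedDensity F (k + Fintype.card W) :=
    fun n G y hy0 hy => le_ciInf fun k =>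
      lagrangian_le_inducedDensity F G hy0 hy (Nat.le_add_left _ _)
  refine ⟨⨅ k, inducedDensity F (k + Fintype.card W), ?_, hlag⟩
  have hlim := tendsto_const_nhds (x := ⨅ k, inducedDensity F (k + Fintype.card W)).div
    (tendsto_descFactorial_div_pow (Fintype.card W)) one_ne_zero
  rw [div_one] at hlim
  refine tendsto_of_tendsto_of_tendsto_of_le_of_le' tendsto_const_nhds hlim ?_ ?_
  · filter_upwards [eventually_ge_atTop (Fintype.card W)] with n hn
    have := ciInf_le hbdd (n - Fintype.card W)
    rwa [Nat.sub_add_cancel hn] at this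
  · filter_upwards [eventually_ge_atTop (Fintype.card W), eventually_gt_atTop 0] with n hn hn0
    have hn' : (0 : ℝ) < n := by exact_mod_cast hn0
    have hd : (0 : ℝ) < n.descFactorial (Fintype.card W) := by
      exact_mod_cast Nat.descFactorial_pos.2 hn
    -- The uniform vector on an extremal graph bounds the density by the infimum times `n ^ ℓ /
    -- (n)_ℓ`, a factor tending to `1`.
    obtain ⟨G, hG⟩ := exists_lagrangian_const_eq F hn (n : ℝ)⁻¹
    have h := hlag n G (fun _ => (n : ℝ)⁻¹) (fun _ => by positivity) (by simp [hn'.ne'])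
    rw [hG] at h
    rw [Pi.div_apply, le_div_iff₀ (by positivity)]
    refine le_trans (le_of_eq ?_) h
    rw [inv_pow]
    ring

theorem tendsto_inducedDensity (F : SimpleGraph W) :
    Tendsto (inducedDensity F) atTop (𝓝 (inducibility F)) := by
  obtain ⟨L, hL, _⟩ := exists_inducedDensity_limit F
  exact tendsto_nhds_limUnder ⟨L, hL⟩

theorem inducibility_nonneg (F : SimpleGraph W) : 0 ≤ inducibility F :=
  ge_of_tendsto' (tendsto_inducedDensity F) (inducedDensity_nonneg F)

theorem lagrangian_le_inducibility (F : SimpleGraph W) (G : SimpleGraph (Fin n)) {y : Fin n → ℝ}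
    (hy0 : ∀ i, 0 ≤ y i) (hy : ∑ i, y i = 1) : lagrangian F G y ≤ inducibility F := by
  obtain ⟨L, hL, hlag⟩ := exists_inducedDensity_limit F
  rw [tendsto_nhds_unique (tendsto_inducedDensity F) hL]
  exact hlag n G y hy0 hy

theorem sum_le_rpow_of_mem_alphaSimplex {α : ℝ} (hα : 1 ≤ α) {x : Fin n → ℝ}
    (hx : x ∈ alphaSimplex α n) : ∑ i, x i ≤ (n : ℝ) ^ (1 - 1 / α) := by
  have h0 : 0 < α := by linarith
  have hs : 0 ≤ ∑ i, x i := Finset.sum_nonneg fun i _ => hx.1 i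
  have hx1 : ∑ i, x i ^ α = 1 := by
    rw [← hx.2]
    exact Finset.sum_congr rfl fun i _ => by rw [abs_of_nonneg (hx.1 i)]
  have h := Real.rpow_sum_le_const_mul_sum_rpow_of_nonneg Finset.univ hα fun i _ => hx.1 i
  rw [hx1, mul_one, Finset.card_univ, Fintype.card_fin] at h
  rw [← Real.rpow_le_rpow_iff hs (by positivity) h0, ← Real.rpow_mul (by positivity)]
  convert h using 2
  field_simp

/-- Rescaling an optimal vector to sum `1` costs the factor `(∑ x_i) ^ ℓ`, which the power mean
inequality controls. -/
theorem specInd_le (F : SimpleGraph W) {α : ℝ} (hα : 1 ≤ α) (hn : 1 ≤ n) :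
    specInd α F n ≤ inducibility F * (n : ℝ) ^ ((Fintype.card W : ℝ) * (1 - 1 / α)) := by
  obtain ⟨G, hG⟩ := (isGreatest_specInd α F n).1
  obtain ⟨x, hx, hxG⟩ := optVectors_nonempty hα hn F G
  have h0 : α ≠ 0 := by linarith
  have hs0 : 0 ≤ ∑ i, x i := Finset.sum_nonneg fun i _ => hx.1 i
  have hs : ∑ i, x i ≠ 0 := fun h => by
    have hz := (Finset.sum_eq_zero_iff_of_nonneg fun i _ => hx.1 i).1 h
    have h1 := hx.2
    rw [Finset.sum_congr rfl fun i hi => by rw [hz i hi]] at h1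
    simp [h0] at h1
  have hy := lagrangian_le_inducibility F G (y := (∑ i, x i)⁻¹ • x)
    (fun i => mul_nonneg (by positivity) (hx.1 i))
    (by simp only [Pi.smul_apply, smul_eq_mul]; rw [← Finset.mul_sum, inv_mul_cancel₀ hs])
  have hpow : (∑ i, x i) ^ Fintype.card W ≤
      (n : ℝ) ^ ((Fintype.card W : ℝ) * (1 - 1 / α)) := by
    rw [mul_comm, Real.rpow_mul (by positivity), Real.rpow_natCast]
    exact pow_le_pow_left₀ hs0 (sum_le_rpow_of_mem_alphaSimplex hα hx) _
  have hxy : x = (∑ i, x i) • ((∑ i, x i)⁻¹ • x) := by rw [smul_smul, mul_inv_cancel₀ hs, one_smul]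
  calc specInd α F n = lagrangian F G x := by rw [hxG, ← hG]
    _ = (∑ i, x i) ^ Fintype.card W * lagrangian F G ((∑ i, x i)⁻¹ • x) := by
        rw [← lagrangian_smul, ← hxy]
    _ ≤ (∑ i, x i) ^ Fintype.card W * inducibility F :=
        mul_le_mul_of_nonneg_left hy (by positivity)
    _ ≤ (n : ℝ) ^ ((Fintype.card W : ℝ) * (1 - 1 / α)) * inducibility F :=
        mul_le_mul_of_nonneg_right hpow (inducibility_nonneg F)
    _ = _ := mul_comm _ _

/-- Test vector: all entries `n ^ (-1/α)`, on a graph with the most induced copies. -/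
theorem le_specInd (F : SimpleGraph W) {α : ℝ} (hα : 1 ≤ α) (hn : 1 ≤ n)
    (hcard : Fintype.card W ≤ n) :
    (n.descFactorial (Fintype.card W) : ℝ) / (n : ℝ) ^ Fintype.card W * inducedDensity F n *
      (n : ℝ) ^ ((Fintype.card W : ℝ) * (1 - 1 / α)) ≤ specInd α F n := by
  have h0 : α ≠ 0 := by linarith
  have hn' : (0 : ℝ) < n := by exact_mod_cast hn
  obtain ⟨G, hG⟩ := exists_lagrangian_const_eq F hcard ((n : ℝ) ^ (-(1 / α)))
  have hmem : (fun _ => (n : ℝ) ^ (-(1 / α))) ∈ alphaSphere α n := by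
    change ∑ _i : Fin n, |(n : ℝ) ^ (-(1 / α))| ^ α = 1
    rw [abs_of_nonneg (by positivity), ← Real.rpow_mul hn'.le, Finset.sum_const,
      Finset.card_univ, Fintype.card_fin, nsmul_eq_mul, neg_mul, one_div_mul_cancel h0,
      Real.rpow_neg_one, mul_inv_cancel₀ hn'.ne']
  have hpow : (n : ℝ) ^ ((Fintype.card W : ℝ) * (1 - 1 / α)) =
      (n : ℝ) ^ Fintype.card W * ((n : ℝ) ^ (-(1 / α))) ^ Fintype.card W := by
    rw [← mul_pow, mul_comm, Real.rpow_mul hn'.le, Real.rpow_natCast, sub_eq_add_neg,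
      Real.rpow_add hn', Real.rpow_one]
  calc _ = lagrangian F G fun _ => (n : ℝ) ^ (-(1 / α)) := by
        rw [hG, hpow]
        field_simp
    _ ≤ specRadius α F G := lagrangian_le_specRadius hα hn F G hmem
    _ ≤ specInd α F n := specRadius_le_specInd α F G

theorem tendsto_specInd_div (F : SimpleGraph W) {α : ℝ} (hα : 1 ≤ α) :
    Tendsto (fun n : ℕ => specInd α F n / (n : ℝ) ^ ((Fintype.card W : ℝ) * (1 - 1 / α))) atTop
      (𝓝 (inducibility F)) := by
  have hlow := (tendsto_descFactorial_div_pow (Fintype.card W)).mul (tendsto_inducedDensity F)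
  rw [one_mul] at hlow
  refine tendsto_of_tendsto_of_tendsto_of_le_of_le' hlow tendsto_const_nhds ?_ ?_
  · filter_upwards [eventually_ge_atTop (Fintype.card W), eventually_ge_atTop 1] with n hn hn1
    have hn' : (0 : ℝ) < n := by exact_mod_cast hn1
    rw [le_div_iff₀ (by positivity)]
    exact le_specInd F hα hn1 hn
  · filter_upwards [eventually_ge_atTop 1] with n hn1
    have hn' : (0 : ℝ) < n := by exact_mod_cast hn1
    rw [div_le_iff₀ (by positivity)]
    exact specInd_le F hα hn1

end Asymptotics

end SpecInd

theorem theorem1p1 {W : Type*} [Fintype W] (F : SimpleGraph W) (hF : F.IsCompleteMultipartite) :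
    -- (i) some complete multipartite graph is extremal
    (∀ n : ℕ, 1 ≤ n → ∀ α : ℝ, 1 ≤ α →
      ∃ G : SimpleGraph (Fin n), G.IsCompleteMultipartite ∧
        SpecInd.specRadius α F G = SpecInd.specInd α F n) ∧
    -- (ii) every such graph has an optimal vector that is constant on each part; the parts are
    -- the classes of the equivalence relation of non-adjacency
    (∀ n : ℕ, 1 ≤ n → ∀ α : ℝ, 1 ≤ α →
      ∀ (G : SimpleGraph (Fin n)) (hG : G.IsCompleteMultipartite),
        SpecInd.specRadius α F G = SpecInd.specInd α F n →
        ∃ x ∈ SpecInd.optVectors α F G, ∀ A ∈ hG.setoid.classes, ∀ u ∈ A, ∀ v ∈ A, x u = x v) ∧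
    -- (iii) the limit that defines the inducibility exists, and it is the leading constant
    (Tendsto (SpecInd.inducedDensity F) atTop (𝓝 (SpecInd.inducibility F)) ∧
      ∀ α : ℝ, 1 ≤ α → ∃ ε : ℕ → ℝ, Tendsto ε atTop (𝓝 0) ∧
        ∀ n : ℕ, 1 ≤ n →
          SpecInd.specInd α F n =
            (SpecInd.inducibility F + ε n) * (n : ℝ) ^ ((Fintype.card W : ℝ) * (1 - 1 / α))) := by
  refine ⟨fun n hn α hα => SpecInd.exists_isCompleteMultipartite_specRadius_eq hF hn hα,
    fun n hn α hα G hG _ => ?_, SpecInd.tendsto_inducedDensity F, fun α hα => ?_⟩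
  · obtain ⟨x, hx, hxc⟩ := SpecInd.exists_optVectors_eq_of_not_adj hF hn hα hG
    exact ⟨x, hx, fun A hA u hu v hv => hxc u v (hG.setoid.rel_iff_exists_classes.2 ⟨A, hA, hu, hv⟩)⟩
  · refine ⟨fun n => SpecInd.specInd α F n / (n : ℝ) ^ ((Fintype.card W : ℝ) * (1 - 1 / α)) -
      SpecInd.inducibility F, ?_, fun n hn => ?_⟩
    · simpa using (SpecInd.tendsto_specInd_div F hα).sub_const (SpecInd.inducibility F)
    · have hn' : (0 : ℝ) < n := by exact_mod_cast hn
      have hpos : (n : ℝ) ^ ((Fintype.card W : ℝ) * (1 - 1 / α)) ≠ 0 := by positivity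
      rw [add_sub_cancel, div_mul_cancel₀ _ hpos]
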